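/- Let $a,b,q$ be indeterminates. For an integer $m\ge 0$ put $[m]=1+q+\cdots+q^{m-1}=\frac{1-q^m}{1-q}$, let $(x;q)_k=\prod_{j=0}^{k-1}(1-xq^j)$ for $k\ge 0$ (so $(x;q)_0=1$), write $(x_1,\dots,x_m;q)_k=(x_1;q)_k\cdots(x_m;q)_k$, and let $\Phi_n(q)$ be the $n$-th cyclotomic polynomial in $q$. For a rational function $A\in\mathbb{Q}(a,b)(q)$ and a polynomial $P$ in $q$, write $A\equiv 0\pmod{P}$ if $P$ divides, in $\mathbb{Q}(a,b)[q]$, the numerator of $A$ written in lowest terms as a rational function of $q$. Let $n$ and $d$ be positive integers with $d\geq 3$ and $\gcd(n,d)=1$. Then $$\sum_{k=0}^{n-1}[2dk+1]\frac{(aq,q/a,bq,q/b;q^d)_k\,(q;q^d)_k^2}{(aq^d,q^d/a,bq^d,q^d/b;q^d)_k\,(q^d;q^d)_k^2}\,q^{(2d-3)k} \equiv\begin{cases}0 \pmod{[n]\Phi_n(q)}, &\text{if } n\equiv -1\pmod{d},\\ 0 \pmod{[n]},&\text{otherwise}.\end{cases}$$ -/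

import Mathlib

noncomputable section

namespace QCong

/-- The field `ℚ(a, b)` of rational functions in two indeterminates `a`, `b`. -/
abbrev ParamField : Type := FractionRing (MvPolynomial (Fin 2) ℚ)

/-- The field `ℚ(a, b)(q)` of rational functions in the three indeterminates `a`, `b`, `q`. -/
abbrev RatField : Type := RatFunc ParamField

/-- The indeterminate `a`, as an element of `ℚ(a, b)(q)`. -/
def aVar : RatField :=
  RatFunc.C (algebraMap (MvPolynomial (Fin 2) ℚ) ParamField (MvPolynomial.X 0))

/-- The indeterminate `b`, as an element of `ℚ(a, b)(q)`. -/
def bVar : RatField :=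
  RatFunc.C (algebraMap (MvPolynomial (Fin 2) ℚ) ParamField (MvPolynomial.X 1))

/-- The indeterminate `q`, as an element of `ℚ(a, b)(q)`. -/
def qVar : RatField := RatFunc.X

/-- The `q`-shifted factorial `(x; q)_k = (1 - x)(1 - x q) ⋯ (1 - x q^(k-1))`. -/
def qPoch {R : Type*} [CommRing R] (x q : R) (k : ℕ) : R :=
  ∏ j ∈ Finset.range k, (1 - x * q ^ j)

/-- The `q`-integer `[m] = 1 + q + ⋯ + q^(m-1)`, that is, `(1 - q^m) / (1 - q)`. -/
def qInt {R : Type*} [CommRing R] (q : R) (m : ℕ) : R :=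
  ∑ i ∈ Finset.range m, q ^ i

/-- The congruence `A ≡ B (mod P)` of rational functions of `q` modulo a polynomial `P` in `q`:
the polynomial `P` divides the numerator of `A - B` in lowest terms. -/
def CongMod {F : Type*} [Field F] (A B : RatFunc F) (P : Polynomial F) : Prop :=
  P ∣ (A - B).num

/-- The `k`-th summand
`[2dk+1] (aq, q/a, bq, q/b; q^d)_k (q; q^d)_k^2 q^((2d-3)k)
  / ((aq^d, q^d/a, bq^d, q^d/b; q^d)_k (q^d; q^d)_k^2)`, for `d ≥ 2`. -/
def summand (a b q : RatField) (d k : ℕ) : RatField :=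
  qInt q (2 * d * k + 1) *
    ((qPoch (a * q) (q ^ d) k * qPoch (q / a) (q ^ d) k *
        qPoch (b * q) (q ^ d) k * qPoch (q / b) (q ^ d) k * qPoch q (q ^ d) k ^ 2) /
      (qPoch (a * q ^ d) (q ^ d) k * qPoch (q ^ d / a) (q ^ d) k *
        qPoch (b * q ^ d) (q ^ d) k * qPoch (q ^ d / b) (q ^ d) k *
        qPoch (q ^ d) (q ^ d) k ^ 2)) *
    q ^ ((2 * d - 3) * k)

end QCong

end

/-!
Write `p = q^d`. Up to the factor `1 - q`, the summand is `w_k X_k(a) X_k(b)` with the weight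
`w_k = (1 - q p^(2k)) ((q; p)_k / (p; p)_k)^2 q^(-k)` and
`X_k(α) = (α q, q/α; p)_k / (α p, p/α; p)_k (p/q)^k`.

The q-Pfaff–Saalschütz sum (`ratioProd_eq_sum`) expands `X_k(α)` as `∑_l c_l(α) g_l(k)`, where
`g_l(k) = (p^(-k); p)_l (q p^k; p)_l` is a polynomial of degree `l` in `p^(-k) + q p^k` and `c_l`
contains `(p/q; p)_l`. Products `g_l g_l'` are combinations of the `g_L` with `L ≤ l + l'`, and the
coefficients are Laurent polynomials in `q` (`sum_mul_newtonBasis_mul_mem`). So everything reduces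
to the sums `K_L = ∑_{k<n} w_k g_L(k)`, which telescope (`sum_newtonBasis`): `(1 - q p^L) K_L` is a
product containing `(q; p)_n (q; p)_(n+L)`, hence divisible by `Φ_n(q)^2`.

It follows that `Φ_n(q)` divides every `K_L`, and `Φ_n(q)^2` does unless `n ∣ 1 + d L`. If
`d t = n + 1`, then `c_l` is divisible by `Φ_n(q)` for `l ≥ t`, while `l, l' < t` leaves only degrees
`L ≤ 2t - 2`, for which `n ∤ 1 + d L`. Thus `Φ_n(q)^2` divides the whole sum
(`IsCyclotomicLocal.sum_mem_two`).

For a divisor `e > 1` of `n`, the terms in each block of length `e` are, modulo `Φ_e(q)`, a constant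
multiple of those in the first block, whose sum vanishes by the case `n = e`
(`IsCyclotomicLocal.sum_mul_mem_one`). Since `[n]` is the product of the pairwise coprime `Φ_e(q)`
over these `e`, the congruences combine. Divisibility by powers of `Φ_e(q)` is expressed inside the
subring of rational functions whose denominator is coprime to `Φ_e(q)`.
-/

noncomputable section
namespace QCong
open Finset

/-! ### The q-Saalschütz expansion and an indefinite sum -/
section Basis
variable {K : Type*} [Field K]

/-- The product `(p^(-k); p)_l (q p^k; p)_l`. For fixed `l` it is a polynomial of degree `l` in
`p^(-k) + q p^k`, and these polynomials form a Newton basis with nodes `k = 0, 1, 2, …`. -/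
def newtonBasis (q p : K) (l k : ℕ) : K :=
  ∏ j ∈ range l, (1 - p ^ j / p ^ k) * (1 - q * p ^ j * p ^ k)

theorem newtonBasis_eq_zero {q p : K} (hp : p ≠ 0) {l k : ℕ} (h : k < l) :
    newtonBasis q p l k = 0 :=
  prod_eq_zero (mem_range.2 h) (by simp [hp])

theorem newtonBasis_succ (q p : K) (l k : ℕ) : newtonBasis q p (l + 1) k =
    newtonBasis q p l k * ((1 - p ^ l / p ^ k) * (1 - q * p ^ l * p ^ k)) :=
  prod_range_succ _ _

theorem newtonBasis_succ_mul (q : K) {p : K} (hp : p ≠ 0) (l k : ℕ) :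
    newtonBasis q p l (k + 1) * ((1 - p ^ l / p ^ (k + 1)) * (1 - q * p ^ k)) =
      newtonBasis q p l k * ((1 - 1 / p ^ (k + 1)) * (1 - q * p ^ l * p ^ k)) := by
  induction l with
  | zero => simp [newtonBasis]
  | succ l ih =>
    rw [newtonBasis_succ, newtonBasis_succ]
    have h1 : p ^ (l + 1) / p ^ (k + 1) = p ^ l / p ^ k := by
      rw [pow_succ, pow_succ, mul_div_mul_right _ _ hp]
    have h2 : q * p ^ l * p ^ (k + 1) = q * p ^ (l + 1) * p ^ k := by ring
    rw [h1, h2]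
    linear_combination ((1 - q * p ^ (l + 1) * p ^ k) * (1 - p ^ l / p ^ k)) * ih

/-- The factor that leads from `newtonBasis q p j` to `newtonBasis q p (j + 1)` is linear in
`p^(-k) + q p^k`, so it can be rewritten through the factor that belongs to `l`. This is what
linearizes products of two basis elements, with coefficients that are Laurent polynomials
in `q` and `p`. -/
theorem newtonFactor_mul_newtonBasis (q : K) {p : K} (hp : p ≠ 0) (j l k : ℕ) :
    (1 - p ^ j / p ^ k) * (1 - q * p ^ j * p ^ k) * newtonBasis q p l k =
      p ^ j * (p⁻¹) ^ l * newtonBasis q p (l + 1) k +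
        (1 + q * p ^ (2 * j) - p ^ j * (p⁻¹) ^ l * (1 + q * p ^ (2 * l))) *
          newtonBasis q p l k := by
  rw [newtonBasis_succ, inv_pow]
  field_simp
  ring

/-- The part `(α q, q/α; p)_k / (α p, p/α; p)_k * (p/q)^k` of the summand that depends on the
parameter `α`. The power of `p/q` is the one for which the expansion in the Newton basis holds. -/
def ratioProd (q p α : K) (k : ℕ) : K :=
  ∏ j ∈ range k, p / q * ((1 - α * q * p ^ j) * (1 - q / α * p ^ j)) /
    ((1 - α * p ^ (j + 1)) * (1 - p ^ (j + 1) / α))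

/-- The coefficient `(p/q; p)_l p^l / (p, α p, p/α; p)_l` in the Newton expansion of
`ratioProd`. -/
def ratioCoeff (q p α : K) (l : ℕ) : K :=
  ∏ j ∈ range l, p * (1 - p ^ (j + 1) / q) /
    ((1 - p ^ (j + 1)) * ((1 - α * p ^ (j + 1)) * (1 - p ^ (j + 1) / α)))

/-- Partial sums of the defect in the recurrence in `k` for the Saalschütz sum. The closed form on
the right vanishes once `k < N`, which makes the recurrence exact. -/
theorem saalschuetz_step {q p α : K} (hq : q ≠ 0) (hp : p ≠ 0) (hα : α ≠ 0)
    (h1 : ∀ j : ℕ, 1 - p ^ (j + 1) ≠ 0) (h2 : ∀ j : ℕ, 1 - α * p ^ (j + 1) ≠ 0)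
    (h3 : ∀ j : ℕ, 1 - p ^ (j + 1) / α ≠ 0) (k N : ℕ) :
    ∑ l ∈ range (N + 1), ratioCoeff q p α l *
        (newtonBasis q p l (k + 1) - p / q * ((1 - α * q * p ^ k) * (1 - q / α * p ^ k)) /
          ((1 - α * p ^ (k + 1)) * (1 - p ^ (k + 1) / α)) * newtonBasis q p l k) =
      (1 - q * p ^ (2 * k + 1)) / ((1 - α * p ^ (k + 1)) * (1 - p ^ (k + 1) / α)) *
        (∏ j ∈ range N, (1 - p ^ j / p ^ k) * (1 - q * p ^ (j + 1) * p ^ k)) *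
        ratioCoeff q p α N * (1 - p ^ (N + 1) / q) / p ^ N := by
  have e2 := h2 k
  have e3 : α - p ^ (k + 1) ≠ 0 := by
    intro h; apply h3 k; rw [one_sub_div hα, h, zero_div]
  induction N with
  | zero =>
    simp only [zero_add, range_one, sum_singleton, ratioCoeff, newtonBasis, prod_range_zero]
    field_simp
    ring
  | succ N ih =>
    rw [sum_range_succ, ih]
    have f1 := h1 N
    have f2 := h2 N
    have f3 : α - p ^ (N + 1) ≠ 0 := by
      intro h; apply h3 N; rw [one_sub_div hα, h, zero_div]
    have g1 : newtonBasis q p (N + 1) (k + 1) =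
        (∏ j ∈ range N, (1 - p ^ j / p ^ k) * (1 - q * p ^ (j + 1) * p ^ k)) *
          ((1 - 1 / p ^ (k + 1)) * (1 - q * p ^ (N + 1) * p ^ k)) := by
      rw [newtonBasis, prod_mul_distrib, prod_mul_distrib, prod_range_succ',
        prod_range_succ (fun j => 1 - q * p ^ j * p ^ (k + 1))]
      have : ∀ j : ℕ, p ^ (j + 1) / p ^ (k + 1) = p ^ j / p ^ k := fun j => by
        rw [pow_succ, pow_succ, mul_div_mul_right _ _ hp]
      have h' : ∀ j : ℕ, q * p ^ j * p ^ (k + 1) = q * p ^ (j + 1) * p ^ k := fun j => by ring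
      simp only [this, h', pow_zero]
      ring
    have g2 : newtonBasis q p (N + 1) k =
        (∏ j ∈ range N, (1 - p ^ j / p ^ k) * (1 - q * p ^ (j + 1) * p ^ k)) *
          ((1 - p ^ N / p ^ k) * (1 - q * p ^ k)) := by
      rw [newtonBasis, prod_mul_distrib, prod_mul_distrib, prod_range_succ,
        prod_range_succ' (fun j => 1 - q * p ^ j * p ^ k)]
      simp only [pow_zero, mul_one]
      ring
    rw [g1, g2, prod_range_succ]
    have g3 : ratioCoeff q p α (N + 1) = ratioCoeff q p α N * (p * (1 - p ^ (N + 1) / q) /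
        ((1 - p ^ (N + 1)) * ((1 - α * p ^ (N + 1)) * (1 - p ^ (N + 1) / α)))) := by
      rw [ratioCoeff, prod_range_succ, ← ratioCoeff]
    rw [g3]
    generalize (∏ j ∈ range N, (1 - p ^ j / p ^ k) * (1 - q * p ^ (j + 1) * p ^ k)) = H
    generalize ratioCoeff q p α N = C
    have hpk : p ^ k ≠ 0 := pow_ne_zero _ hp
    have hpN : p ^ N ≠ 0 := pow_ne_zero _ hp
    simp only [pow_succ, pow_mul, pow_zero, one_mul, mul_comm 2 k] at e2 e3 f1 f2 f3 ⊢
    generalize p ^ k = y at *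
    generalize p ^ N = x at *
    rw [mul_comm x p] at f1 f3
    rw [show α * (x * p) = p * α * x by ring] at f2
    rw [show α * (y * p) = y * p * α by ring] at e2
    field_simp
    ring

/-- The q-Pfaff–Saalschütz summation, read as a Newton expansion of `ratioProd` in the variable
`p^(-k) + q p^k`. -/
theorem ratioProd_eq_sum {q p α : K} (hq : q ≠ 0) (hp : p ≠ 0) (hα : α ≠ 0)
    (h1 : ∀ j : ℕ, 1 - p ^ (j + 1) ≠ 0) (h2 : ∀ j : ℕ, 1 - α * p ^ (j + 1) ≠ 0)
    (h3 : ∀ j : ℕ, 1 - p ^ (j + 1) / α ≠ 0) {k N : ℕ} (hk : k < N) :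
    ratioProd q p α k = ∑ l ∈ range N, ratioCoeff q p α l * newtonBasis q p l k := by
  induction k with
  | zero =>
    obtain ⟨N, rfl⟩ := Nat.exists_eq_succ_of_ne_zero hk.ne'
    rw [sum_range_succ', sum_eq_zero fun l _ => by
      rw [newtonBasis_eq_zero hp (Nat.succ_pos l), mul_zero]]
    simp [ratioProd, ratioCoeff, newtonBasis]
  | succ k ih =>
    obtain ⟨N, rfl⟩ := Nat.exists_eq_succ_of_ne_zero (Nat.ne_of_gt (Nat.zero_lt_of_lt hk))
    have key := saalschuetz_step hq hp hα h1 h2 h3 k N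
    have hz : (∏ j ∈ range N, (1 - p ^ j / p ^ k) * (1 - q * p ^ (j + 1) * p ^ k)) = 0 :=
      prod_eq_zero (mem_range.2 (show k < N by omega)) (by simp [hp])
    rw [hz, mul_zero, zero_mul, zero_mul, zero_div] at key
    rw [ratioProd, prod_range_succ, ← ratioProd, ih (by omega), mul_comm, ← sub_eq_zero,
      ← neg_eq_zero, ← key, mul_sum, ← sum_sub_distrib, ← sum_neg_distrib]
    exact sum_congr rfl fun l _ => by ring

/-- The weighted sum of one Newton basis element up to any bound has a closed form: the
product on the right telescopes in its upper bound. -/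
theorem sum_newtonBasis {q p : K} (hq : q ≠ 0) (hp : p ≠ 0)
    (h1 : ∀ j : ℕ, 1 - p ^ (j + 1) ≠ 0) (L n : ℕ) :
    (1 - q * p ^ L) * ∑ k ∈ range (n + 1), (1 - q * p ^ (2 * k)) *
        (qPoch q p k / qPoch p p k) ^ 2 * q⁻¹ ^ k * newtonBasis q p L k =
      (qPoch q p n / qPoch p p n) ^ 2 * q⁻¹ ^ n * (1 - q * p ^ n) * (1 - q * p ^ (n + L)) *
        newtonBasis q p L n := by
  induction n with
  | zero => simp [qPoch]; ring
  | succ n ih =>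
    rw [sum_range_succ, mul_add, ih]
    have hs := newtonBasis_succ_mul q hp L n
    have hn := h1 n
    have hx : qPoch p p (n + 1) = qPoch p p n * (1 - p ^ (n + 1)) := by
      rw [qPoch, prod_range_succ, ← qPoch]; ring
    have hy : qPoch q p (n + 1) = qPoch q p n * (1 - q * p ^ n) := by
      rw [qPoch, prod_range_succ, ← qPoch]
    rw [hx, hy, mul_div_mul_comm]
    generalize qPoch q p n / qPoch p p n = e
    generalize newtonBasis q p L (n + 1) = G1 at *
    generalize newtonBasis q p L n = G0 at *
    have hpn : p ^ n ≠ 0 := pow_ne_zero _ hp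
    have hqn : q ^ n ≠ 0 := pow_ne_zero _ hq
    have hpL : p ^ L ≠ 0 := pow_ne_zero _ hp
    simp only [pow_succ, pow_mul, pow_add, pow_zero, one_mul, mul_comm 2 (n+1), inv_pow] at hn hs ⊢
    generalize p ^ n = y at *
    generalize p ^ L = x at *
    generalize q ^ n = z at *
    field_simp at hs ⊢
    linear_combination (1 - y * q) * e ^ 2 * q * (1 - y * p) * hs

end Basis

/-! ### Congruences modulo the square of one cyclotomic factor -/
section LocalRing
variable {K : Type*} [Field K]

/-- The additive group of multiples `φ ^ i * r` with `r ∈ R`, inside the ambient field. -/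
def powMultiples (R : Subring K) (φ : K) (i : ℕ) : AddSubgroup K :=
  R.toAddSubgroup.map (AddMonoidHom.mulLeft (φ ^ i))

variable {R : Subring K} {φ q : K} {n : ℕ}

theorem mem_powMultiples {i : ℕ} {x : K} :
    x ∈ powMultiples R φ i ↔ ∃ r ∈ R, φ ^ i * r = x :=
  Iff.rfl

theorem mul_mem_powMultiples {i j : ℕ} {x y : K} (hx : x ∈ powMultiples R φ i)
    (hy : y ∈ powMultiples R φ j) : x * y ∈ powMultiples R φ (i + j) := by
  obtain ⟨r, hr, rfl⟩ := mem_powMultiples.1 hx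
  obtain ⟨s, hs, rfl⟩ := mem_powMultiples.1 hy
  exact mem_powMultiples.2 ⟨r * s, mul_mem hr hs, by ring⟩

theorem mem_powMultiples_zero {x : K} : x ∈ powMultiples R φ 0 ↔ x ∈ R := by
  simp [mem_powMultiples]

theorem mem_powMultiples_mul_right {i : ℕ} {x y : K} (hx : x ∈ powMultiples R φ i)
    (hy : y ∈ R) : x * y ∈ powMultiples R φ i :=
  mul_mem_powMultiples hx (mem_powMultiples_zero.2 hy)

theorem mem_powMultiples_mul_left {i : ℕ} {x y : K} (hx : x ∈ R)
    (hy : y ∈ powMultiples R φ i) : x * y ∈ powMultiples R φ i :=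
  mul_comm y x ▸ mem_powMultiples_mul_right hy hx

/-- Two elements of `R` are congruent modulo `φ R`. -/
def CongIn (R : Subring K) (φ x y : K) : Prop :=
  x ∈ R ∧ y ∈ R ∧ x - y ∈ powMultiples R φ 1

theorem CongIn.refl {x : K} (hx : x ∈ R) : CongIn R φ x x :=
  ⟨hx, hx, by rw [sub_self]; exact zero_mem _⟩

theorem CongIn.mul {x y x' y' : K} (h : CongIn R φ x y) (h' : CongIn R φ x' y') :
    CongIn R φ (x * x') (y * y') := by
  refine ⟨mul_mem h.1 h'.1, mul_mem h.2.1 h'.2.1, ?_⟩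
  rw [show x * x' - y * y' = (x - y) * x' + y * (x' - y') by ring]
  exact add_mem (mem_powMultiples_mul_right h.2.2 h'.1) (mem_powMultiples_mul_left h.2.1 h'.2.2)

theorem CongIn.one_sub {x y : K} (h : CongIn R φ x y) : CongIn R φ (1 - x) (1 - y) := by
  refine ⟨sub_mem (one_mem _) h.1, sub_mem (one_mem _) h.2.1, ?_⟩
  rw [show 1 - x - (1 - y) = -(x - y) by ring]
  exact neg_mem h.2.2

theorem CongIn.inv {x y : K} (h : CongIn R φ x y) (hx : x ≠ 0) (hy : y ≠ 0) (hx' : x⁻¹ ∈ R)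
    (hy' : y⁻¹ ∈ R) : CongIn R φ x⁻¹ y⁻¹ := by
  refine ⟨hx', hy', ?_⟩
  rw [show x⁻¹ - y⁻¹ = -(x - y) * (x⁻¹ * y⁻¹) by field_simp; ring]
  exact mem_powMultiples_mul_right (neg_mem h.2.2) (mul_mem hx' hy')

theorem CongIn.prod {f g : ℕ → K} {k : ℕ} (h : ∀ j < k, CongIn R φ (f j) (g j)) :
    CongIn R φ (∏ j ∈ range k, f j) (∏ j ∈ range k, g j) := by
  induction k with
  | zero => exact CongIn.refl (one_mem _)
  | succ k ih =>
    rw [prod_range_succ, prod_range_succ]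
    exact (ih fun j hj => h j (by omega)).mul (h k (by omega))

/-- The properties of the local ring `R` of the cyclotomic polynomial `φ = Φ_n(q)`: the element `q`
is a unit of infinite order, and `1 - q ^ s` is a unit of `R` if `n ∤ s`, and `φ` times a unit of
`R` if `n ∣ s` and `s` is positive. -/
structure IsCyclotomicLocal (R : Subring K) (φ q : K) (n : ℕ) : Prop where
  q_ne : q ≠ 0
  q_mem : q ∈ R
  q_inv_mem : q⁻¹ ∈ R
  one_sub_ne : ∀ s : ℕ, 0 < s → 1 - q ^ s ≠ 0
  inv_mem : ∀ s : ℕ, ¬ n ∣ s → (1 - q ^ s)⁻¹ ∈ R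
  dvd_mem : ∀ s : ℕ, n ∣ s → 1 - q ^ s ∈ powMultiples R φ 1
  simple : ∀ s : ℕ, 0 < s → φ * (1 - q ^ s)⁻¹ ∈ R

/-- The parameter `α` is a unit of `R` for which all denominators `1 - α q^s` and `1 - q^s/α` are
units of `R` as well. -/
structure IsGenericParam (R : Subring K) (q α : K) : Prop where
  ne : α ≠ 0
  mem : α ∈ R
  inv_mem : α⁻¹ ∈ R
  ne₁ : ∀ s : ℕ, 1 - α * q ^ s ≠ 0
  inv_mem₁ : ∀ s : ℕ, (1 - α * q ^ s)⁻¹ ∈ R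
  ne₂ : ∀ s : ℕ, 1 - q ^ s / α ≠ 0
  inv_mem₂ : ∀ s : ℕ, (1 - q ^ s / α)⁻¹ ∈ R

/-- The part `(1 - q p^(2k)) ((q; p)_k / (p; p)_k)^2 q^(-k)` of the summand that does not depend
on the parameters, up to the constant `1 - q`. -/
def weight (q p : K) (k : ℕ) : K :=
  (1 - q * p ^ (2 * k)) * (qPoch q p k / qPoch p p k) ^ 2 * q⁻¹ ^ k

theorem exists_dvd_one_add_mul {n d : ℕ} (hn : 0 < n) (h : n.Coprime d) :
    ∃ m < n, n ∣ 1 + d * m := by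
  have : NeZero n := ⟨hn.ne'⟩
  refine ⟨((-(d : ZMod n)⁻¹ : ZMod n)).val, ZMod.val_lt _, ?_⟩
  rw [← ZMod.natCast_eq_zero_iff]
  push_cast
  rw [ZMod.natCast_zmod_val, mul_neg, ZMod.coe_mul_inv_eq_one d h.symm, add_neg_cancel]

/-- A sum against a product of two Newton basis elements inherits the divisibility of the sums
against single basis elements of no larger degree. -/
theorem sum_mul_newtonBasis_mul_mem {p : K} (hp : p ≠ 0) (hq : q ∈ R) (hpR : p ∈ R)
    (hpR' : p⁻¹ ∈ R) (w : ℕ → K) (i N : ℕ) :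
    ∀ l' l : ℕ, (∀ L ≤ l + l', ∑ k ∈ range N, w k * newtonBasis q p L k ∈ powMultiples R φ i) →
      ∑ k ∈ range N, w k * (newtonBasis q p l k * newtonBasis q p l' k) ∈ powMultiples R φ i
  | 0, l, h => by simpa [newtonBasis] using h l le_rfl
  | l' + 1, l, h => by
    have h1 := sum_mul_newtonBasis_mul_mem hp hq hpR hpR' w i N l' (l + 1)
      fun L hL => h L (by omega)
    have h2 := sum_mul_newtonBasis_mul_mem hp hq hpR hpR' w i N l' l fun L hL => h L (by omega)
    have hc : p ^ l' * p⁻¹ ^ l ∈ R := mul_mem (pow_mem hpR _) (pow_mem hpR' _)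
    have hc' : 1 + q * p ^ (2 * l') - p ^ l' * p⁻¹ ^ l * (1 + q * p ^ (2 * l)) ∈ R :=
      sub_mem (add_mem (one_mem _) (mul_mem hq (pow_mem hpR _)))
        (mul_mem hc (add_mem (one_mem _) (mul_mem hq (pow_mem hpR _))))
    convert add_mem (mem_powMultiples_mul_left hc h1) (mem_powMultiples_mul_left hc' h2) using 1
    rw [mul_sum, mul_sum, ← sum_add_distrib]
    refine sum_congr rfl fun k _ => ?_
    have := newtonFactor_mul_newtonBasis q hp l' l k
    rw [newtonBasis_succ q p l']
    linear_combination w k * newtonBasis q p l' k * this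

namespace IsCyclotomicLocal
variable {d : ℕ}

theorem pow_ne (h : IsCyclotomicLocal R φ q n) : q ^ d ≠ 0 := pow_ne_zero _ h.q_ne

theorem one_sub_pow_ne (h : IsCyclotomicLocal R φ q n) (hd : 0 < d) (j : ℕ) :
    1 - (q ^ d) ^ (j + 1) ≠ 0 := by
  rw [← pow_mul]
  exact h.one_sub_ne _ (Nat.mul_pos hd j.succ_pos)

theorem one_sub_pow_inv_mem (h : IsCyclotomicLocal R φ q n) (hnd : n.Coprime d) {j : ℕ}
    (hj : ¬ n ∣ j) : (1 - (q ^ d) ^ j)⁻¹ ∈ R := by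
  rw [← pow_mul]
  exact h.inv_mem _ fun hh => hj (hnd.dvd_of_dvd_mul_left hh)

theorem one_sub_mul_mem (h : IsCyclotomicLocal R φ q n) (j : ℕ) : 1 - q * (q ^ d) ^ j ∈ R :=
  sub_mem (one_mem _) (mul_mem h.q_mem (pow_mem (pow_mem h.q_mem _) _))

/-- Since `d` is invertible modulo `n`, one of the first `n` factors `1 - q^(1 + d j)` is divisible
by `φ`. -/
theorem qPoch_mem (h : IsCyclotomicLocal R φ q n) (hn : 0 < n) (hnd : n.Coprime d) {k : ℕ}
    (hk : n ≤ k) : qPoch q (q ^ d) k ∈ powMultiples R φ 1 := by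
  obtain ⟨m, hm, hdvd⟩ := exists_dvd_one_add_mul hn hnd
  rw [qPoch, ← mul_prod_erase _ _ (mem_range.2 (hm.trans_le hk))]
  refine mem_powMultiples_mul_right ?_ (prod_mem fun j _ => h.one_sub_mul_mem j)
  rw [← pow_mul, ← pow_succ', add_comm (d * m)]
  exact h.dvd_mem _ hdvd

theorem one_div_qPoch_mem (h : IsCyclotomicLocal R φ q n) (hnd : n.Coprime d) {k : ℕ}
    (hk : k < n) : (qPoch (q ^ d) (q ^ d) k)⁻¹ ∈ R := by
  rw [qPoch, ← prod_inv_distrib]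
  refine prod_mem fun j hj => ?_
  rw [mem_range] at hj
  rw [← pow_succ']
  exact h.one_sub_pow_inv_mem hnd fun hh => absurd (Nat.le_of_dvd j.succ_pos hh) (by omega)

/-- The closed form of the sum contains `(q; q^d)_n` and `(q; q^d)_(n+L)`, each of which contributes
a factor `φ`. -/
theorem mul_sum_weight_mem (h : IsCyclotomicLocal R φ q n) (hn : 0 < n) (hd : 0 < d)
    (hnd : n.Coprime d) (L : ℕ) :
    (1 - q ^ (1 + d * L)) * ∑ k ∈ range n, weight q (q ^ d) k * newtonBasis q (q ^ d) L k ∈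
      powMultiples R φ 2 := by
  obtain ⟨N, rfl⟩ := Nat.exists_eq_succ_of_ne_zero hn.ne'
  have key := sum_newtonBasis h.q_ne (h.pow_ne (d := d)) (h.one_sub_pow_ne hd) L N
  rw [pow_add, pow_one, pow_mul]
  simp only [weight]
  rw [key]
  have e : (qPoch q (q ^ d) N / qPoch (q ^ d) (q ^ d) N) ^ 2 * q⁻¹ ^ N * (1 - q * (q ^ d) ^ N) *
      (1 - q * (q ^ d) ^ (N + L)) * newtonBasis q (q ^ d) L N =
      (qPoch q (q ^ d) (N + 1) * qPoch q (q ^ d) (N + (L + 1))) *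
        ((qPoch (q ^ d) (q ^ d) N)⁻¹ ^ 2 * q⁻¹ ^ N *
          ∏ j ∈ range L, (1 - (q ^ d) ^ j * ((q⁻¹) ^ d) ^ N)) := by
    have e1 : qPoch q (q ^ d) (N + 1) = qPoch q (q ^ d) N * (1 - q * (q ^ d) ^ N) :=
      prod_range_succ _ _
    have e2 : qPoch q (q ^ d) (N + (L + 1)) = qPoch q (q ^ d) N *
        ((∏ j ∈ range L, (1 - q * (q ^ d) ^ j * (q ^ d) ^ N)) * (1 - q * (q ^ d) ^ (N + L))) := by
      rw [qPoch, prod_range_add, prod_range_succ, ← qPoch]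
      congr 2
      exact prod_congr rfl fun j _ => by ring
    rw [e1, e2, newtonBasis, prod_mul_distrib]
    simp only [div_eq_mul_inv, inv_pow]
    ring
  rw [e]
  have hqi := h.q_inv_mem
  refine mem_powMultiples_mul_right
    (mul_mem_powMultiples (h.qPoch_mem hn hnd le_rfl) (h.qPoch_mem hn hnd (by omega)))
    (mul_mem (mul_mem (pow_mem (h.one_div_qPoch_mem hnd (Nat.lt_succ_self N)) _) (pow_mem hqi _))
      (prod_mem fun j _ => sub_mem (one_mem _) (mul_mem (pow_mem (pow_mem h.q_mem _) _)
        (pow_mem (pow_mem hqi _) _))))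

theorem sum_weight_mem_two (h : IsCyclotomicLocal R φ q n) (hn : 0 < n) (hd : 0 < d)
    (hnd : n.Coprime d) {L : ℕ} (hL : ¬ n ∣ 1 + d * L) :
    ∑ k ∈ range n, weight q (q ^ d) k * newtonBasis q (q ^ d) L k ∈ powMultiples R φ 2 := by
  have := mem_powMultiples_mul_left (h.inv_mem _ hL) (h.mul_sum_weight_mem hn hd hnd L)
  rwa [inv_mul_cancel_left₀ (h.one_sub_ne _ (by omega))] at this

/-- Dividing by `1 - q^(1 + d L)` costs at most one factor `φ`. -/
theorem sum_weight_mem_one (h : IsCyclotomicLocal R φ q n) (hn : 0 < n) (hd : 0 < d)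
    (hnd : n.Coprime d) (L : ℕ) :
    ∑ k ∈ range n, weight q (q ^ d) k * newtonBasis q (q ^ d) L k ∈ powMultiples R φ 1 := by
  obtain ⟨r, hr, e⟩ := mem_powMultiples.1 (h.mul_sum_weight_mem hn hd hnd L)
  have h0 := h.one_sub_ne (1 + d * L) (by omega)
  refine mem_powMultiples.2 ⟨_, mul_mem (h.simple (1 + d * L) (by omega)) hr, ?_⟩
  rw [← inv_mul_cancel_left₀ h0 (∑ k ∈ range n, _), ← e]
  ring

variable {α β : K}

theorem ratioCoeff_mem (h : IsCyclotomicLocal R φ q n) (hnd : n.Coprime d)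
    (hα : IsGenericParam R q α) {l : ℕ} (hl : l < n) : ratioCoeff q (q ^ d) α l ∈ R := by
  refine prod_mem fun j hj => ?_
  rw [mem_range] at hj
  have hp : q ^ d ∈ R := pow_mem h.q_mem _
  rw [div_eq_mul_inv, div_eq_mul_inv, mul_inv, mul_inv]
  refine mul_mem (mul_mem hp (sub_mem (one_mem _) (mul_mem (pow_mem hp _) h.q_inv_mem)))
    (mul_mem (h.one_sub_pow_inv_mem hnd fun hh =>
      absurd (Nat.le_of_dvd j.succ_pos hh) (by omega)) ?_)
  rw [← pow_mul]
  exact mul_mem (hα.inv_mem₁ _) (hα.inv_mem₂ _)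

/-- If `d t = n + 1`, then `(q^d/q; q^d)_l` contains the factor `1 - q^(d t - 1) = 1 - q^n` as soon
as `t ≤ l`. -/
theorem ratioCoeff_mem_one (h : IsCyclotomicLocal R φ q n) (hnd : n.Coprime d)
    (hα : IsGenericParam R q α) {l t : ℕ} (hl : l < n) (ht : d * t = n + 1) (hlt : t ≤ l) :
    ratioCoeff q (q ^ d) α l ∈ powMultiples R φ 1 := by
  obtain ⟨l, rfl⟩ := Nat.exists_eq_add_of_le hlt
  obtain ⟨t, rfl⟩ : ∃ t', t = t' + 1 := ⟨t - 1, by rcases t with _ | t <;> simp_all⟩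
  have hp : q ^ d ∈ R := pow_mem h.q_mem _
  have hj : ∀ j < t + 1 + l, (1 - (q ^ d) ^ (j + 1))⁻¹ *
      ((1 - α * (q ^ d) ^ (j + 1))⁻¹ * (1 - (q ^ d) ^ (j + 1) / α)⁻¹) ∈ R := fun j hj => by
    refine mul_mem (h.one_sub_pow_inv_mem hnd fun hh =>
      absurd (Nat.le_of_dvd j.succ_pos hh) (by omega)) ?_
    rw [← pow_mul]
    exact mul_mem (hα.inv_mem₁ _) (hα.inv_mem₂ _)
  rw [ratioCoeff, ← mul_prod_erase _ _ (mem_range.2 (show t < t + 1 + l by omega))]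
  refine mem_powMultiples_mul_right ?_ (prod_mem fun j hj' => ?_)
  · rw [div_eq_mul_inv, mul_inv, mul_inv]
    refine mem_powMultiples_mul_right (mem_powMultiples_mul_left hp ?_) (hj t (by omega))
    rw [← pow_mul, ht, pow_succ, mul_div_cancel_right₀ _ h.q_ne]
    exact h.dvd_mem n dvd_rfl
  · rw [div_eq_mul_inv, div_eq_mul_inv _ q, mul_inv, mul_inv]
    exact mul_mem (mul_mem hp (sub_mem (one_mem _) (mul_mem (pow_mem hp _) h.q_inv_mem)))
      (hj j (by simpa using (mem_erase.1 hj').2))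

theorem sum_eq (h : IsCyclotomicLocal R φ q n) (hd : 0 < d)
    (hα : IsGenericParam R q α) (hβ : IsGenericParam R q β) :
    ∑ k ∈ range n, weight q (q ^ d) k * (ratioProd q (q ^ d) α k * ratioProd q (q ^ d) β k) =
      ∑ l ∈ range n, ∑ l' ∈ range n, ratioCoeff q (q ^ d) α l * ratioCoeff q (q ^ d) β l' *
        ∑ k ∈ range n, weight q (q ^ d) k *
          (newtonBasis q (q ^ d) l k * newtonBasis q (q ^ d) l' k) := by
  have exp : ∀ {γ : K}, IsGenericParam R q γ → ∀ k ∈ range n, ratioProd q (q ^ d) γ k =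
      ∑ l ∈ range n, ratioCoeff q (q ^ d) γ l * newtonBasis q (q ^ d) l k := fun {γ} hγ k hk =>
    ratioProd_eq_sum h.q_ne h.pow_ne hγ.ne (h.one_sub_pow_ne hd)
      (fun j => by rw [← pow_mul]; exact hγ.ne₁ _) (fun j => by rw [← pow_mul]; exact hγ.ne₂ _)
      (mem_range.1 hk)
  calc _ = ∑ k ∈ range n, ∑ l ∈ range n, ∑ l' ∈ range n, ratioCoeff q (q ^ d) α l *
        ratioCoeff q (q ^ d) β l' * (weight q (q ^ d) k *
          (newtonBasis q (q ^ d) l k * newtonBasis q (q ^ d) l' k)) :=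
        sum_congr rfl fun k hk => by
          rw [exp hα k hk, exp hβ k hk, sum_mul_sum, mul_sum]
          refine sum_congr rfl fun l _ => ?_
          rw [mul_sum]
          exact sum_congr rfl fun l' _ => by ring
    _ = _ := by
        rw [sum_comm]
        refine sum_congr rfl fun l _ => ?_
        rw [sum_comm]
        exact sum_congr rfl fun l' _ => by rw [mul_sum]

theorem sum_mem_one (h : IsCyclotomicLocal R φ q n) (hn : 0 < n) (hd : 0 < d)
    (hnd : n.Coprime d) (hα : IsGenericParam R q α) (hβ : IsGenericParam R q β) :
    ∑ k ∈ range n, weight q (q ^ d) k * (ratioProd q (q ^ d) α k * ratioProd q (q ^ d) β k) ∈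
      powMultiples R φ 1 := by
  rw [h.sum_eq hd hα hβ]
  refine sum_mem fun l hl => sum_mem fun l' hl' => ?_
  rw [mem_range] at hl hl'
  refine mem_powMultiples_mul_left (mul_mem (h.ratioCoeff_mem hnd hα hl)
    (h.ratioCoeff_mem hnd hβ hl')) (sum_mul_newtonBasis_mul_mem h.pow_ne h.q_mem
    (pow_mem h.q_mem _) (by rw [← inv_pow]; exact pow_mem h.q_inv_mem _) _ _ _ _ _
    fun L _ => h.sum_weight_mem_one hn hd hnd L)

/-- With `d t = n + 1`, a term of the double expansion is divisible by `φ ^ 2` in two ways: if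
`t ≤ l` or `t ≤ l'`, its coefficient supplies one factor `φ` and the sum over `k` the other;
otherwise all degrees `L ≤ l + l'` that occur are too small for `n ∣ 1 + d L`. -/
theorem sum_mem_two (h : IsCyclotomicLocal R φ q n) (hn : 0 < n) (hd : 3 ≤ d)
    (hnd : n.Coprime d) (hα : IsGenericParam R q α) (hβ : IsGenericParam R q β)
    (hmod : d ∣ n + 1) :
    ∑ k ∈ range n, weight q (q ^ d) k * (ratioProd q (q ^ d) α k * ratioProd q (q ^ d) β k) ∈
      powMultiples R φ 2 := by
  obtain ⟨t, ht⟩ := hmod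
  have hd0 : 0 < d := by omega
  rw [h.sum_eq hd0 hα hβ]
  refine sum_mem fun l hl => sum_mem fun l' hl' => ?_
  rw [mem_range] at hl hl'
  have hA := h.ratioCoeff_mem hnd hα hl
  have hB := h.ratioCoeff_mem hnd hβ hl'
  have lin := fun i => sum_mul_newtonBasis_mul_mem (φ := φ) (h.pow_ne (d := d)) h.q_mem
    (pow_mem h.q_mem d) (by rw [← inv_pow]; exact pow_mem h.q_inv_mem _)
    (weight q (q ^ d)) i n l' l
  have one := lin 1 fun L _ => h.sum_weight_mem_one hn hd0 hnd L
  by_cases h1 : t ≤ l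
  · exact mul_mem_powMultiples (mem_powMultiples_mul_right
      (h.ratioCoeff_mem_one hnd hα hl ht.symm h1) hB) one
  by_cases h2 : t ≤ l'
  · exact mul_mem_powMultiples (mem_powMultiples_mul_left hA
      (h.ratioCoeff_mem_one hnd hβ hl' ht.symm h2)) one
  -- Here `1 + d L < 2 n`, so `n ∣ 1 + d L` would force `n ≡ 1` as well as `n ≡ -1` modulo `d`.
  refine mem_powMultiples_mul_left (mul_mem hA hB) (lin 2 fun L hL =>
    h.sum_weight_mem_two hn hd0 hnd ?_)
  rintro ⟨c, hc⟩
  have hLt : d * (L + 2) ≤ d * (2 * t) := Nat.mul_le_mul_left d (by omega)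
  have hlt : 1 + d * L < n * 2 := by nlinarith
  rw [hc] at hlt
  have hc2 : c < 2 := lt_of_mul_lt_mul_left hlt (Nat.zero_le n)
  have hc1 : c = 1 := by
    rcases c with _ | _ | c
    · omega
    · rfl
    · omega
  subst hc1
  have h2 : d ∣ 2 := by
    rw [← Nat.dvd_add_right (⟨L, rfl⟩ : d ∣ d * L)]
    exact ⟨t, by omega⟩
  exact absurd (Nat.le_of_dvd two_pos h2) (by omega)

end IsCyclotomicLocal
end LocalRing

/-! ### Sums over several periods modulo one cyclotomic factor -/
section Blocks
variable {K : Type*} [Field K] {R : Subring K} {φ q : K} {e d : ℕ}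

/-- The quotient of two consecutive terms of the sum, leaving aside the very-well-poised factor
`1 - q p^(2k)`. -/
def termRatio (q p α β : K) (j : ℕ) : K :=
  ((1 - q * p ^ j) * (1 - p ^ (j + 1))⁻¹) ^ 2 *
    (q⁻¹ * (p / q * ((1 - α * q * p ^ j) * (1 - q / α * p ^ j)) /
      ((1 - α * p ^ (j + 1)) * (1 - p ^ (j + 1) / α)) *
    (p / q * ((1 - β * q * p ^ j) * (1 - q / β * p ^ j)) /
      ((1 - β * p ^ (j + 1)) * (1 - p ^ (j + 1) / β)))))

theorem weight_mul_ratioProd (q p α β : K) (k : ℕ) :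
    weight q p k * (ratioProd q p α k * ratioProd q p β k) =
      (1 - q * p ^ (2 * k)) * ∏ j ∈ range k, termRatio q p α β j := by
  have h : qPoch p p k = ∏ j ∈ range k, (1 - p ^ (j + 1)) :=
    prod_congr rfl fun j _ => by rw [pow_succ']
  simp only [termRatio, prod_mul_distrib, prod_pow, prod_const, card_range]
  rw [weight, ← ratioProd, ← ratioProd, h, qPoch, prod_inv_distrib, ← div_eq_mul_inv]
  ring

namespace IsCyclotomicLocal
variable {α β : K}

theorem congIn_pow (h : IsCyclotomicLocal R φ q e) (u j : ℕ) :
    CongIn R φ ((q ^ d) ^ (u * e + j)) ((q ^ d) ^ j) := by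
  have hp : ∀ i, (q ^ d) ^ i ∈ R := fun i => pow_mem (pow_mem h.q_mem _) _
  refine ⟨hp _, hp _, ?_⟩
  rw [show (q ^ d) ^ (u * e + j) - (q ^ d) ^ j = -(1 - q ^ (d * (u * e))) * (q ^ d) ^ j by
    rw [pow_add, pow_mul q d]; ring]
  exact mem_powMultiples_mul_right
    (neg_mem (h.dvd_mem _ (Dvd.intro_left (d * u) (by ring)))) (hp j)

theorem congIn_paramRatio (h : IsCyclotomicLocal R φ q e) (hα : IsGenericParam R q α) (u j : ℕ) :
    CongIn R φ (q ^ d / q * ((1 - α * q * (q ^ d) ^ (u * e + j)) *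
          (1 - q / α * (q ^ d) ^ (u * e + j))) /
        ((1 - α * (q ^ d) ^ (u * e + j + 1)) * (1 - (q ^ d) ^ (u * e + j + 1) / α)))
      (q ^ d / q * ((1 - α * q * (q ^ d) ^ j) * (1 - q / α * (q ^ d) ^ j)) /
        ((1 - α * (q ^ d) ^ (j + 1)) * (1 - (q ^ d) ^ (j + 1) / α))) := by
  have c0 := h.congIn_pow (d := d) u j
  have c1 := h.congIn_pow (d := d) u (j + 1)
  rw [← add_assoc] at c1
  have n1 : ∀ i, 1 - α * (q ^ d) ^ i ≠ 0 := fun i => by rw [← pow_mul]; exact hα.ne₁ _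
  have n2 : ∀ i, 1 - (q ^ d) ^ i / α ≠ 0 := fun i => by rw [← pow_mul]; exact hα.ne₂ _
  have m1 : ∀ i, (1 - α * (q ^ d) ^ i)⁻¹ ∈ R := fun i => by
    rw [← pow_mul]; exact hα.inv_mem₁ _
  have m2 : ∀ i, (1 - (q ^ d) ^ i / α)⁻¹ ∈ R := fun i => by
    rw [← pow_mul]; exact hα.inv_mem₂ _
  have d1 := ((CongIn.refl hα.mem).mul c1).one_sub.inv (n1 _) (n1 _) (m1 _) (m1 _)
  have d2 : CongIn R φ (1 - (q ^ d) ^ (u * e + j + 1) / α)⁻¹ (1 - (q ^ d) ^ (j + 1) / α)⁻¹ :=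
    CongIn.inv (by simpa only [div_eq_mul_inv] using
      (c1.mul (CongIn.refl hα.inv_mem)).one_sub) (n2 _) (n2 _) (m2 _) (m2 _)
  have a1 := ((CongIn.refl (φ := φ) (mul_mem hα.mem h.q_mem)).mul c0).one_sub
  have a2 := ((CongIn.refl (φ := φ) (mul_mem h.q_mem hα.inv_mem)).mul c0).one_sub
  have b := CongIn.refl (φ := φ) (mul_mem (pow_mem h.q_mem d) h.q_inv_mem)
  have := (b.mul (a1.mul a2)).mul (d1.mul d2)
  simpa only [div_eq_mul_inv, mul_inv] using this

/-- The term ratio is periodic modulo `φ` with period `e`, except at the last index of a period,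
where its denominator is divisible by `φ`. -/
theorem congIn_termRatio (h : IsCyclotomicLocal R φ q e) (hd : 0 < d) (hed : e.Coprime d)
    (hα : IsGenericParam R q α) (hβ : IsGenericParam R q β) (u : ℕ) {j : ℕ} (hj : j + 1 < e) :
    CongIn R φ (termRatio q (q ^ d) α β (u * e + j)) (termRatio q (q ^ d) α β j) := by
  have c0 := ((CongIn.refl h.q_mem).mul (h.congIn_pow (d := d) u j)).one_sub
  have hndvd : ¬ e ∣ j + 1 := fun hh => absurd (Nat.le_of_dvd j.succ_pos hh) (by omega)
  have c1 : CongIn R φ (1 - (q ^ d) ^ (u * e + j + 1))⁻¹ (1 - (q ^ d) ^ (j + 1))⁻¹ := by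
    refine CongIn.inv (by simpa only [add_assoc] using (h.congIn_pow u (j + 1)).one_sub)
      (h.one_sub_pow_ne hd _) (h.one_sub_pow_ne hd _) (h.one_sub_pow_inv_mem hed fun hh => ?_)
      (h.one_sub_pow_inv_mem hed hndvd)
    rw [add_assoc, Nat.dvd_add_right (Dvd.intro_left u rfl)] at hh
    exact hndvd hh
  have c2 := c0.mul c1
  have := (c2.mul c2).mul ((CongIn.refl h.q_inv_mem).mul
    ((h.congIn_paramRatio (d := d) hα u j).mul (h.congIn_paramRatio (d := d) hβ u j)))
  simpa only [termRatio, pow_two] using this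

/-- Over a full period exactly one factor `1 - q^(d(j+1))` of the denominator is divisible by `φ`,
only once, and one factor `1 - q^(1+dj)` of the numerator makes up for it. -/
theorem prod_termRatio_block_mem (h : IsCyclotomicLocal R φ q e) (he : 0 < e)
    (hed : e.Coprime d) (hα : IsGenericParam R q α) (hβ : IsGenericParam R q β) (u : ℕ) :
    ∏ j ∈ range e, termRatio q (q ^ d) α β (u * e + j) ∈ R := by
  simp only [termRatio]
  rw [prod_mul_distrib, prod_pow]
  refine mul_mem (pow_mem ?_ 2) (prod_mem fun j _ => mul_mem h.q_inv_mem
    (mul_mem (h.congIn_paramRatio hα u j).1 (h.congIn_paramRatio hβ u j).1))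
  rw [prod_mul_distrib]
  have hnum : ∏ j ∈ range e, (1 - q * (q ^ d) ^ (u * e + j)) ∈ powMultiples R φ 1 := by
    obtain ⟨m, hm, hdvd⟩ := exists_dvd_one_add_mul he hed
    rw [← mul_prod_erase _ _ (mem_range.2 hm)]
    refine mem_powMultiples_mul_right ?_ (prod_mem fun j _ => h.one_sub_mul_mem _)
    rw [← pow_mul, ← pow_succ']
    refine h.dvd_mem _ ?_
    rw [show d * (u * e + m) + 1 = e * (d * u) + (1 + d * m) by ring]
    exact dvd_add (Dvd.intro _ rfl) hdvd
  have hden : φ * ∏ j ∈ range e, (1 - (q ^ d) ^ (u * e + j + 1))⁻¹ ∈ R := by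
    obtain ⟨e', rfl⟩ := Nat.exists_eq_succ_of_ne_zero he.ne'
    rw [prod_range_succ, mul_comm (∏ _ ∈ _, _), ← mul_assoc]
    refine mul_mem ?_ (prod_mem fun j hj => h.one_sub_pow_inv_mem hed fun hh => ?_)
    · rw [← pow_mul]
      rcases Nat.eq_zero_or_pos d with rfl | hd
      · simp
      · exact h.simple _ (Nat.mul_pos hd (Nat.succ_pos _))
    · rw [mem_range] at hj
      rw [add_assoc, Nat.dvd_add_right (Dvd.intro_left u rfl)] at hh
      exact absurd (Nat.le_of_dvd j.succ_pos hh) (by omega)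
  obtain ⟨r, hr, hre⟩ := mem_powMultiples.1 hnum
  rw [← hre, pow_one, mul_comm φ r, mul_assoc]
  exact mul_mem hr hden

theorem prod_termRatio_mem (h : IsCyclotomicLocal R φ q e) (he : 0 < e)
    (hed : e.Coprime d) (hα : IsGenericParam R q α) (hβ : IsGenericParam R q β) (u : ℕ) :
    ∏ j ∈ range (u * e), termRatio q (q ^ d) α β j ∈ R := by
  induction u with
  | zero => simp
  | succ u ih =>
    rw [Nat.succ_mul, prod_range_add]
    exact mul_mem ih (h.prod_termRatio_block_mem he hed hα hβ u)

/-- Modulo `φ`, every block of `e` consecutive terms is a constant multiple of the first block. -/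
theorem sum_mul_mem_one (h : IsCyclotomicLocal R φ q e) (he : 0 < e) (hd : 0 < d)
    (hed : e.Coprime d) (hα : IsGenericParam R q α) (hβ : IsGenericParam R q β) (s : ℕ) :
    ∑ k ∈ range (s * e),
      weight q (q ^ d) k * (ratioProd q (q ^ d) α k * ratioProd q (q ^ d) β k) ∈
        powMultiples R φ 1 := by
  induction s with
  | zero => simp
  | succ s ih =>
    rw [Nat.succ_mul, sum_range_add]
    refine add_mem ih ?_
    have h0 := mem_powMultiples_mul_left (h.prod_termRatio_mem he hed hα hβ s)
      (h.sum_mem_one he hd hed hα hβ)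
    rw [← add_sub_cancel (_ * _) (∑ x ∈ range e, _)]
    refine add_mem h0 ?_
    rw [mul_sum, ← sum_sub_distrib]
    refine sum_mem fun v hv => ?_
    rw [mem_range] at hv
    rw [weight_mul_ratioProd, weight_mul_ratioProd, prod_range_add, mul_left_comm, ← mul_sub]
    refine mem_powMultiples_mul_left (h.prod_termRatio_mem he hed hα hβ s) ?_
    refine (CongIn.mul ?_ (CongIn.prod fun j hj =>
      h.congIn_termRatio hd hed hα hβ s (by omega))).2.2
    have := h.congIn_pow (d := d) (2 * s) (2 * v)
    rw [show 2 * s * e + 2 * v = 2 * (s * e + v) by ring] at this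
    exact ((CongIn.refl h.q_mem).mul this).one_sub

end IsCyclotomicLocal
end Blocks

/-! ### The local ring of a cyclotomic polynomial -/
section Localization
open Polynomial
variable {F : Type*} [Field F]

/-- The rational functions that have some representation with denominator coprime to `P`. `P`
need not be irreducible, so that irreducibility of the cyclotomic polynomials over `ℚ(a, b)` plays
no role. -/
def locSubring (P : F[X]) : Subring (RatFunc F) where
  carrier := {A | ∃ x y : F[X], IsCoprime y P ∧
    A * algebraMap F[X] (RatFunc F) y = algebraMap F[X] (RatFunc F) x}
  mul_mem' := by
    rintro A B ⟨x, y, hy, h⟩ ⟨x', y', hy', h'⟩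
    exact ⟨x * x', y * y', hy.mul_left hy', by rw [map_mul, map_mul, ← h, ← h']; ring⟩
  one_mem' := ⟨1, 1, isCoprime_one_left, by simp⟩
  add_mem' := by
    rintro A B ⟨x, y, hy, h⟩ ⟨x', y', hy', h'⟩
    exact ⟨x * y' + x' * y, y * y', hy.mul_left hy', by
      rw [map_add, map_mul, map_mul, map_mul, ← h, ← h']; ring⟩
  zero_mem' := ⟨0, 1, isCoprime_one_left, by simp⟩
  neg_mem' := by
    rintro A ⟨x, y, hy, h⟩
    exact ⟨-x, y, hy, by rw [map_neg, ← h, neg_mul]⟩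

theorem algebraMap_mem_locSubring (P x : F[X]) :
    algebraMap F[X] (RatFunc F) x ∈ locSubring P :=
  ⟨x, 1, isCoprime_one_left, by simp⟩

theorem inv_algebraMap_mem_locSubring {P y : F[X]} (hy : IsCoprime y P) (hy0 : y ≠ 0) :
    (algebraMap F[X] (RatFunc F) y)⁻¹ ∈ locSubring P :=
  ⟨1, y, hy, by rw [map_one, inv_mul_cancel₀ (RatFunc.algebraMap_ne_zero hy0)]⟩

theorem pow_dvd_num_of_mem {P : F[X]} {i : ℕ} {A : RatFunc F}
    (h : A ∈ powMultiples (locSubring P) (algebraMap F[X] (RatFunc F) P) i) : P ^ i ∣ A.num := by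
  obtain ⟨r, ⟨x, y, hy, hr⟩, rfl⟩ := mem_powMultiples.1 h
  set A := algebraMap F[X] (RatFunc F) P ^ i * r with hA
  have h1 : A * algebraMap F[X] (RatFunc F) y = algebraMap F[X] (RatFunc F) (P ^ i * x) := by
    rw [map_mul, map_pow, ← hr, hA]; ring
  rw [← RatFunc.num_div_denom A, div_mul_eq_mul_div,
    div_eq_iff (RatFunc.algebraMap_ne_zero (RatFunc.denom_ne_zero A)), ← map_mul, ← map_mul] at h1
  have h2 := RatFunc.algebraMap_injective F h1
  exact (IsCoprime.pow_left hy.symm).dvd_of_dvd_mul_right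
    (h2 ▸ Dvd.intro _ (mul_assoc _ _ _).symm)

theorem isCoprime_cyclotomic [CharZero F] {m n : ℕ} (h : m ≠ n) :
    IsCoprime (cyclotomic m F) (cyclotomic n F) := by
  have := (cyclotomic.isCoprime_rat h).map (mapRingHom (algebraMap ℚ F))
  simpa using this

theorem one_sub_X_pow_ne {s : ℕ} (hs : 0 < s) : (1 - X ^ s : F[X]) ≠ 0 := by
  rw [← neg_sub, neg_ne_zero, ← C_1]
  exact X_pow_sub_C_ne_zero hs 1

theorem isCyclotomicLocal [CharZero F] {n : ℕ} (hn : 0 < n) :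
    IsCyclotomicLocal (locSubring (cyclotomic n F))
      (algebraMap F[X] (RatFunc F) (cyclotomic n F)) RatFunc.X n := by
  have hX : (RatFunc.X : RatFunc F) = algebraMap F[X] (RatFunc F) X := (RatFunc.algebraMap_X).symm
  have hs : ∀ s : ℕ, (1 - RatFunc.X ^ s : RatFunc F) = algebraMap F[X] (RatFunc F) (1 - X ^ s) :=
    fun s => by rw [hX, map_sub, map_one, map_pow]
  have hprod : ∀ {s : ℕ}, 0 < s → (1 - X ^ s : F[X]) = -∏ i ∈ s.divisors, cyclotomic i F :=
    fun hs => by rw [prod_cyclotomic_eq_X_pow_sub_one hs]; ring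
  have hinv : ∀ s : ℕ, ¬ n ∣ s → (1 - RatFunc.X ^ s : RatFunc F)⁻¹ ∈
      locSubring (cyclotomic n F) := fun s h => by
    have hs0 : 0 < s := Nat.pos_of_ne_zero fun hh => h (hh ▸ dvd_zero n)
    rw [hs]
    refine inv_algebraMap_mem_locSubring ?_ (one_sub_X_pow_ne hs0)
    rw [hprod hs0]
    refine (IsCoprime.prod_left fun i hi => isCoprime_cyclotomic ?_).neg_left
    rintro rfl
    exact h (Nat.dvd_of_mem_divisors hi)
  refine ⟨RatFunc.X_ne_zero, hX ▸ algebraMap_mem_locSubring _ _, ?_, ?_, hinv, ?_, ?_⟩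
  · rw [hX]
    refine inv_algebraMap_mem_locSubring ?_ X_ne_zero
    obtain ⟨y, hy⟩ := cyclotomic.dvd_X_pow_sub_one n F
    refine ⟨X ^ (n - 1), -y, ?_⟩
    rw [← pow_succ, Nat.sub_add_cancel hn, neg_mul, mul_comm y, ← hy]
    ring
  · intro s h
    rw [hs]
    exact RatFunc.algebraMap_ne_zero (one_sub_X_pow_ne h)
  · rintro s h
    obtain ⟨y, hy⟩ : cyclotomic n F ∣ 1 - X ^ s := by
      obtain ⟨c, rfl⟩ := h
      rw [← neg_sub, dvd_neg]
      refine (cyclotomic.dvd_X_pow_sub_one n F).trans ?_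
      simpa [pow_mul] using sub_dvd_pow_sub_pow (X ^ n : F[X]) 1 c
    rw [hs, hy, map_mul]
    exact mem_powMultiples.2 ⟨_, algebraMap_mem_locSubring _ y, by rw [pow_one]⟩
  · intro s h0
    by_cases h : n ∣ s
    · have hmem : n ∈ s.divisors := Nat.mem_divisors.2 ⟨h, h0.ne'⟩
      have hc0 : algebraMap F[X] (RatFunc F) (cyclotomic n F) ≠ 0 :=
        RatFunc.algebraMap_ne_zero (cyclotomic_ne_zero n F)
      have hne : ∏ i ∈ s.divisors.erase n, cyclotomic i F ≠ 0 :=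
        prod_ne_zero_iff.2 fun i _ => cyclotomic_ne_zero i F
      rw [hs, hprod h0, ← mul_prod_erase _ _ hmem, map_neg, map_mul, inv_neg, mul_inv, mul_neg,
        mul_inv_cancel_left₀ hc0]
      exact neg_mem (inv_algebraMap_mem_locSubring (IsCoprime.prod_left fun i hi =>
        isCoprime_cyclotomic (mem_erase.1 hi).1) hne)
    · exact mul_mem (algebraMap_mem_locSubring _ _) (hinv s h)

/-- Modulo `Φ_n` one has `X ^ n = 1`, so `1 - c X^s` divides the nonzero constant `1 - c^n`. -/
theorem isCoprime_one_sub_C_mul {n : ℕ} {c : F} (hc : c ^ n ≠ 1) (s : ℕ) :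
    IsCoprime (1 - C c * X ^ s) (cyclotomic n F) := by
  obtain ⟨y, hy⟩ : cyclotomic n F ∣ (X ^ s) ^ n - 1 := by
    rw [← pow_mul, mul_comm, pow_mul]
    refine (cyclotomic.dvd_X_pow_sub_one n F).trans ?_
    simpa using sub_dvd_pow_sub_pow (X ^ n : F[X]) 1 s
  obtain ⟨z, hz⟩ : (1 - C c * X ^ s) ∣ 1 - (C c * X ^ s) ^ n := by
    simpa using sub_dvd_pow_sub_pow (1 : F[X]) (C c * X ^ s) n
  have h0 : 1 - c ^ n ≠ 0 := sub_ne_zero.2 hc.symm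
  refine ⟨C (1 - c ^ n)⁻¹ * z, C (1 - c ^ n)⁻¹ * (C (c ^ n) * y), ?_⟩
  have : C (1 - c ^ n)⁻¹ * (1 - C (c ^ n)) = (1 : F[X]) := by
    rw [← C_1, ← C_sub, ← C_mul, inv_mul_cancel₀ h0]
  rw [mul_pow, ← C_pow] at hz
  linear_combination this - C (1 - c ^ n)⁻¹ * hz - C (1 - c ^ n)⁻¹ * C (c ^ n) * hy

theorem isGenericParam {n : ℕ} (c : F) (hc0 : c ≠ 0) (hc : c ^ n ≠ 1) :
    IsGenericParam (locSubring (cyclotomic n F)) RatFunc.X (RatFunc.C c) := by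
  have hX : (RatFunc.X : RatFunc F) = algebraMap F[X] (RatFunc F) X := (RatFunc.algebraMap_X).symm
  have hC : ∀ c : F, (RatFunc.C c : RatFunc F) = algebraMap F[X] (RatFunc F) (C c) :=
    fun c => (RatFunc.algebraMap_C c).symm
  have hci : (c⁻¹) ^ n ≠ 1 := by rwa [inv_pow, Ne, inv_eq_one]
  have hne : ∀ {c : F}, c ^ n ≠ 1 → ∀ s : ℕ, (1 - C c * X ^ s : F[X]) ≠ 0 := fun {c} h s h0 => by
    have h1 := congrArg (eval 1) h0
    simp only [eval_sub, eval_one, eval_mul, eval_C, eval_pow, eval_X, one_pow, mul_one,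
      eval_zero] at h1
    exact h (by rw [← sub_eq_zero.1 h1, one_pow])
  have hs : ∀ (c : F) (s : ℕ), (1 - RatFunc.C c * RatFunc.X ^ s : RatFunc F) =
      algebraMap F[X] (RatFunc F) (1 - C c * X ^ s) :=
    fun c s => by rw [hX, hC, map_sub, map_one, map_mul, map_pow]
  have hs' : ∀ (s : ℕ), (1 - RatFunc.X ^ s / RatFunc.C c : RatFunc F) =
      algebraMap F[X] (RatFunc F) (1 - C c⁻¹ * X ^ s) :=
    fun s => by rw [← hs, map_inv₀, div_eq_mul_inv, mul_comm]
  refine ⟨by simpa using hc0, hC c ▸ algebraMap_mem_locSubring _ _, ?_, fun s => ?_, fun s => ?_,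
    fun s => ?_, fun s => ?_⟩
  · rw [← map_inv₀, hC]; exact algebraMap_mem_locSubring _ _
  · rw [hs]; exact RatFunc.algebraMap_ne_zero (hne hc s)
  · rw [hs]; exact inv_algebraMap_mem_locSubring (isCoprime_one_sub_C_mul hc s) (hne hc s)
  · rw [hs']; exact RatFunc.algebraMap_ne_zero (hne hci s)
  · rw [hs']; exact inv_algebraMap_mem_locSubring (isCoprime_one_sub_C_mul hci s) (hne hci s)

end Localization

open Polynomial

/-! ### Assembling the cyclotomic factors -/
theorem summand_eq {q : RatField} (hq : q ≠ 1) (hq0 : q ≠ 0) (a b : RatField) {d : ℕ} (hd : 3 ≤ d)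
    (k : ℕ) : summand a b q d k = (1 - q)⁻¹ *
      (weight q (q ^ d) k * (ratioProd q (q ^ d) a k * ratioProd q (q ^ d) b k)) := by
  have hX : ∀ c : RatField, ratioProd q (q ^ d) c k = (q ^ d / q) ^ k *
      (qPoch (c * q) (q ^ d) k * qPoch (q / c) (q ^ d) k /
        (qPoch (c * q ^ d) (q ^ d) k * qPoch (q ^ d / c) (q ^ d) k)) := fun c => by
    simp only [ratioProd, qPoch]
    rw [prod_div_distrib, prod_mul_distrib, prod_mul_distrib, prod_mul_distrib, prod_const,
      card_range, mul_div_assoc]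
    congr 3
    · exact prod_congr rfl fun j _ => by rw [pow_succ']; ring
    · exact prod_congr rfl fun j _ => by rw [pow_succ']; ring
  have hI : qInt q (2 * d * k + 1) = (1 - q)⁻¹ * (1 - q * (q ^ d) ^ (2 * k)) := by
    rw [eq_inv_mul_iff_mul_eq₀ (sub_ne_zero.2 hq.symm), qInt, mul_neg_geom_sum, ← pow_mul,
      ← pow_succ', show d * (2 * k) + 1 = 2 * d * k + 1 by ring]
  have hpow : q ^ ((2 * d - 3) * k) = (q ^ d / q) ^ k * (q ^ d / q) ^ k * q⁻¹ ^ k := by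
    rw [← mul_pow, ← mul_pow, pow_mul]
    congr 1
    obtain ⟨c, rfl⟩ := Nat.exists_eq_add_of_le hd
    rw [show 2 * (3 + c) - 3 = 2 * c + 3 by omega]
    field_simp
    ring
  rw [summand, hI, hX, hX, hpow, weight]
  simp only [div_eq_mul_inv, mul_inv, mul_pow, inv_pow]
  ring

theorem X_ne_zero_and_pow_ne_one (i : Fin 2) {n : ℕ} (hn : 0 < n) :
    algebraMap (MvPolynomial (Fin 2) ℚ) ParamField (MvPolynomial.X i) ≠ 0 ∧
      algebraMap (MvPolynomial (Fin 2) ℚ) ParamField (MvPolynomial.X i) ^ n ≠ 1 := by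
  have hinj := IsFractionRing.injective (MvPolynomial (Fin 2) ℚ) ParamField
  refine ⟨fun h => MvPolynomial.X_ne_zero (R := ℚ) i (hinj (by rw [h, map_zero])), fun h => ?_⟩
  rw [← map_pow] at h
  have h1 := hinj (h.trans (map_one _).symm)
  have h2 := congrArg (MvPolynomial.eval fun _ => (0 : ℚ)) h1
  simp [hn.ne'] at h2

/-- Each `Φ_e` with `e ∣ n` and `e > 1` divides the numerator of the sum, and `Φ_n ^ 2` does so if
`n ≡ -1` modulo `d`. -/
theorem cyclotomic_pow_dvd {n d e s i : ℕ} (he : 1 < e) (hd : 3 ≤ d) (hed : e.Coprime d)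
    (hn : n = s * e) (hi : i = 1 ∨ i = 2 ∧ s = 1 ∧ d ∣ e + 1) :
    cyclotomic e ParamField ^ i ∣ (∑ k ∈ range n, summand aVar bVar qVar d k).num := by
  have he0 : 0 < e := by omega
  have hloc := isCyclotomicLocal (F := ParamField) he0
  have ha : IsGenericParam (locSubring (cyclotomic e ParamField)) RatFunc.X aVar :=
    isGenericParam (F := ParamField) _ (X_ne_zero_and_pow_ne_one 0 he0).1
      (X_ne_zero_and_pow_ne_one 0 he0).2
  have hb : IsGenericParam (locSubring (cyclotomic e ParamField)) RatFunc.X bVar :=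
    isGenericParam (F := ParamField) _ (X_ne_zero_and_pow_ne_one 1 he0).1
      (X_ne_zero_and_pow_ne_one 1 he0).2
  have hq : qVar ≠ 1 := fun h => hloc.one_sub_ne 1 one_pos (by
    rw [pow_one, sub_eq_zero]; exact h.symm)
  refine pow_dvd_num_of_mem ?_
  rw [sum_congr rfl fun k _ => summand_eq hq RatFunc.X_ne_zero aVar bVar hd k, ← mul_sum]
  refine mem_powMultiples_mul_left ?_ ?_
  · have := hloc.inv_mem 1 fun h => absurd (Nat.le_of_dvd one_pos h) (by omega)
    rwa [pow_one] at this
  · rcases hi with rfl | ⟨rfl, rfl, hde⟩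
    · rw [hn]
      exact hloc.sum_mul_mem_one he0 (by omega) hed ha hb s
    · rw [hn, one_mul]
      exact hloc.sum_mem_two he0 hd hed ha hb hde

end QCong
end

theorem theorem1p1 (n d : ℕ) (hn : 0 < n) (hd : 3 ≤ d) (hnd : Nat.Coprime n d) :
    ((n : ℤ) ≡ -1 [ZMOD (d : ℤ)] →
      QCong.CongMod
        (∑ k ∈ Finset.range n, QCong.summand QCong.aVar QCong.bVar QCong.qVar d k) 0
        (QCong.qInt (Polynomial.X : Polynomial QCong.ParamField) n *
          Polynomial.cyclotomic n QCong.ParamField)) ∧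
    (¬ (n : ℤ) ≡ -1 [ZMOD (d : ℤ)] →
      QCong.CongMod
        (∑ k ∈ Finset.range n, QCong.summand QCong.aVar QCong.bVar QCong.qVar d k) 0
        (QCong.qInt (Polynomial.X : Polynomial QCong.ParamField) n)) := by
  have hprod : QCong.qInt (Polynomial.X : Polynomial QCong.ParamField) n =
      ∏ e ∈ n.divisors.erase 1, Polynomial.cyclotomic e QCong.ParamField :=
    (Polynomial.prod_cyclotomic_eq_geom_sum hn _).symm
  have hdvd : ∀ e ∈ n.divisors.erase 1, Polynomial.cyclotomic e QCong.ParamField ∣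
      (∑ k ∈ Finset.range n, QCong.summand QCong.aVar QCong.bVar QCong.qVar d k).num := by
    intro e he
    obtain ⟨he1, hen⟩ := Finset.mem_erase.1 he
    have hen' := Nat.dvd_of_mem_divisors hen
    have he0 := Nat.pos_of_mem_divisors hen
    obtain ⟨s, hs⟩ := id hen'
    simpa using QCong.cyclotomic_pow_dvd (s := s) (i := 1) (by omega) hd
      (hnd.coprime_dvd_left hen') (by rw [hs, mul_comm]) (Or.inl rfl)
  refine ⟨fun hmod => ?_, fun _ => ?_⟩
  · have hdn : d ∣ n + 1 := by
      have := hmod.symm.dvd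
      rw [sub_neg_eq_add] at this
      exact_mod_cast this
    -- For `n = 1` the condition would say `d ∣ 2`.
    have hn1 : n ≠ 1 := by
      rintro rfl
      exact absurd (Nat.le_of_dvd two_pos hdn) (by omega)
    have hmem : n ∈ n.divisors.erase 1 :=
      Finset.mem_erase.2 ⟨hn1, Nat.mem_divisors_self n hn.ne'⟩
    rw [QCong.CongMod, sub_zero, hprod, ← Finset.mul_prod_erase _ _ hmem, mul_right_comm, ← pow_two]
    refine IsCoprime.mul_dvd ?_ (QCong.cyclotomic_pow_dvd (s := 1) (by omega) hd hnd
      (one_mul n).symm (Or.inr ⟨rfl, rfl, hdn⟩)) ?_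
    · exact (IsCoprime.prod_right fun i hi =>
        QCong.isCoprime_cyclotomic (Finset.mem_erase.1 hi).1.symm).pow_left
    · exact Finset.prod_dvd_of_coprime
        (fun i _ j _ hij => QCong.isCoprime_cyclotomic hij)
        fun i hi => hdvd i (Finset.mem_erase.1 hi).2
  · rw [QCong.CongMod, sub_zero, hprod]
    exact Finset.prod_dvd_of_coprime (fun i _ j _ hij => QCong.isCoprime_cyclotomic hij) hdvd
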